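/- Let $n\ge 2$, let $m_1,\dots,m_n>0$, let $0\le a<b$ and $I_0>0$. Let $\Omega=\{\mathbf r=(\mathbf r_1,\dots,\mathbf r_n)\in(\mathbb R^2)^n : \sum_i m_i\mathbf r_i=0\}$, let $\Delta\subset\Omega$ be the set of those $\mathbf r$ with $\mathbf r_i=\mathbf r_j$ for some $i\ne j$, and on $\Omega\setminus\Delta$ let $$U(\mathbf r)=\sum_{i<j}\frac{m_im_j}{\|\mathbf r_i-\mathbf r_j\|^a}+\sum_{i<j}\frac{m_im_j}{\|\mathbf r_i-\mathbf r_j\|^b},\qquad I(\mathbf r)=\sum_i m_i\|\mathbf r_i\|^2 .$$ A configuration $\mathbf r\in\Omega\setminus\Delta$ is central if $\nabla U(\mathbf r)=\sigma\nabla I(\mathbf r)$ for some constant $\sigma\in\mathbb R$. Put $S^*_{I_0}=\{\mathbf r\in\Omega\setminus\Delta: I(\mathbf r)=I_0\}$, and let $S^1$ act on $S^*_{I_0}$ by rotations of the plane about the origin. With $\mathbb R^2=\mathbb C$, identify the complex vector space $\Omega$ with $\mathbb C^{n-1}$ by any complex-linear isomorphism; let $\tilde\Delta\subset\mathbb{CP}^{n-2}$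 be the set of complex lines spanned by the nonzero elements of $\Delta$, and let $\tilde U:\mathbb{CP}^{n-2}\setminus\tilde\Delta\to\mathbb R$ be the induced potential, whose value at a line is the value of $U$ at any point of $S^*_{I_0}$ on that line. Then $\tilde U$ is smooth; the orbit space $S^*_{I_0}/S^1$ has a structure of smooth manifold for which the projection $S^*_{I_0}\to S^*_{I_0}/S^1$ is a smooth submersion; and, for this structure, the map sending the class of $\mathbf r$ to the line $\mathbb C\mathbf r$ is a diffeomorphism of $S^*_{I_0}/S^1$ onto $\mathbb{CP}^{n-2}\setminus\tilde\Delta$ which carries the function induced by $U$ to $\tilde U$, and the set of rotation classes of central configurations with moment of inertia $I_0$ onto the set of critical points of $\tilde U$. In this sense the set of rotation classes of central configurations with moment of inertia $I_0$ is diffeomorphic to the set of critical points of $\tilde U$. -/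

import Mathlib

open scoped Manifold ContDiff Gradient LinearAlgebra.Projectivization

noncomputable section

/-! ### Complex projective space as a smooth real manifold -/

/-- The complex projective space `ℂP^k`: the complex lines through the origin of `ℂ^(k+1)`. -/
def CP (k : ℕ) : Type := ℙ ℂ (Fin (k + 1) → ℂ)

namespace CP

/-- The point of `ℂP^k` with homogeneous coordinates `v`. -/
def mk {k : ℕ} (v : Fin (k + 1) → ℂ) (hv : v ≠ 0) : CP k := Projectivization.mk ℂ v hv

/-- A choice of homogeneous coordinates of a point of `ℂP^k`. -/
def rep {k : ℕ} (p : CP k) : Fin (k + 1) → ℂ := Projectivization.rep p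

theorem rep_ne_zero {k : ℕ} (p : CP k) : p.rep ≠ 0 := Projectivization.rep_nonzero p

theorem mk_rep {k : ℕ} (p : CP k) : mk p.rep p.rep_ne_zero = p := Projectivization.mk_rep p

theorem mk_eq_mk_iff {k : ℕ} (v w : Fin (k + 1) → ℂ) (hv : v ≠ 0) (hw : w ≠ 0) :
    mk v hv = mk w hw ↔ ∃ c : ℂ, c • w = v := Projectivization.mk_eq_mk_iff' ℂ v w hv hw

/-- The quotient topology on `ℂP^k`. -/
instance instTopologicalSpace (k : ℕ) : TopologicalSpace (CP k) :=
  inferInstanceAs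
    (TopologicalSpace (Quotient (projectivizationSetoid ℂ (Fin (k + 1) → ℂ))))

theorem isQuotientMap_mk (k : ℕ) :
    Topology.IsQuotientMap (fun v : {v : Fin (k + 1) → ℂ // v ≠ 0} => mk v.1 v.2) :=
  isQuotientMap_quotient_mk'

theorem rep_mk {k : ℕ} (v : Fin (k + 1) → ℂ) (hv : v ≠ 0) :
    ∃ c : ℂ, c ≠ 0 ∧ (mk v hv).rep = c • v := by
  obtain ⟨c, hc⟩ := Projectivization.exists_smul_eq_mk_rep ℂ v hv
  exact ⟨c, c.ne_zero, hc.symm⟩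

/-- The affine coordinates `z_i / z_j`, `i ≠ j`, of a point of `ℂP^k`. -/
def affine {k : ℕ} (j : Fin (k + 1)) (p : CP k) : Fin k → ℂ :=
  fun i => p.rep (j.succAbove i) / p.rep j

theorem affine_mk {k : ℕ} (j : Fin (k + 1)) (v : Fin (k + 1) → ℂ) (hv : v ≠ 0) :
    affine j (mk v hv) = fun i => v (j.succAbove i) / v j := by
  obtain ⟨c, hc, h⟩ := rep_mk v hv
  funext i
  simp only [affine, h, Pi.smul_apply, smul_eq_mul]
  exact mul_div_mul_left _ _ hc

theorem rep_mk_apply_ne_zero {k : ℕ} (j : Fin (k + 1)) (v : Fin (k + 1) → ℂ) (hv : v ≠ 0) :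
    (mk v hv).rep j ≠ 0 ↔ v j ≠ 0 := by
  obtain ⟨c, hc, h⟩ := rep_mk v hv
  simp [h, hc]

theorem insertNth_ne_zero {k : ℕ} (j : Fin (k + 1)) (z : Fin k → ℂ) :
    (j.insertNth (1 : ℂ) z : Fin (k + 1) → ℂ) ≠ 0 := by
  intro h
  have := congrFun h j
  simp at this

theorem continuous_insertNth {k : ℕ} (j : Fin (k + 1)) :
    Continuous fun z : Fin k → ℂ => (j.insertNth (1 : ℂ) z : Fin (k + 1) → ℂ) := by
  refine continuous_pi fun i => ?_
  rcases Fin.eq_self_or_eq_succAbove j i with rfl | ⟨i, rfl⟩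
  · simpa using continuous_const
  · simpa using continuous_apply i

theorem isOpen_chart_source {k : ℕ} (j : Fin (k + 1)) : IsOpen {p : CP k | p.rep j ≠ 0} := by
  rw [← (isQuotientMap_mk k).isOpen_preimage]
  have : (fun v : {v : Fin (k + 1) → ℂ // v ≠ 0} => mk v.1 v.2) ⁻¹' {p : CP k | p.rep j ≠ 0}
      = {v | v.1 j ≠ 0} := by
    ext v
    exact rep_mk_apply_ne_zero j v.1 v.2
  rw [this]
  exact isOpen_ne_fun ((continuous_apply j).comp continuous_subtype_val) continuous_const

/-- The standard affine chart of `ℂP^k` on the open set `z_j ≠ 0`. -/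
def chart {k : ℕ} (j : Fin (k + 1)) : OpenPartialHomeomorph (CP k) (Fin k → ℂ) where
  toFun := affine j
  invFun z := mk (j.insertNth (1 : ℂ) z) (insertNth_ne_zero j z)
  source := {p | p.rep j ≠ 0}
  target := Set.univ
  map_source' _ _ := Set.mem_univ _
  map_target' z _ := by
    rw [Set.mem_ofPred_eq, rep_mk_apply_ne_zero]
    simp
  left_inv' p hp := by
    conv_rhs => rw [← mk_rep p]
    rw [mk_eq_mk_iff]
    refine ⟨(p.rep j)⁻¹, ?_⟩
    have hp : p.rep j ≠ 0 := hp
    funext i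
    rcases Fin.eq_self_or_eq_succAbove j i with rfl | ⟨i, rfl⟩
    · simp [hp]
    · simp [affine, div_eq_inv_mul]
  right_inv' z _ := by
    rw [affine_mk]
    funext i
    simp
  open_source := isOpen_chart_source j
  open_target := isOpen_univ
  continuousOn_toFun := by
    rw [(isQuotientMap_mk k).continuousOn_isOpen_iff (isOpen_chart_source j)]
    have : affine j ∘ (fun v : {v : Fin (k + 1) → ℂ // v ≠ 0} => mk v.1 v.2)
        = fun v => fun i => v.1 (j.succAbove i) / v.1 j := by
      funext v
      exact affine_mk j v.1 v.2
    rw [this]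
    refine continuousOn_pi.2 fun i => ?_
    refine ContinuousOn.div ((continuous_apply _).comp continuous_subtype_val).continuousOn
      ((continuous_apply j).comp continuous_subtype_val).continuousOn fun v hv => ?_
    exact (rep_mk_apply_ne_zero j v.1 v.2).1 hv
  continuousOn_invFun :=
    ((isQuotientMap_mk k).continuous.comp
      ((continuous_insertNth j).subtype_mk (insertNth_ne_zero j))).continuousOn

theorem exists_rep_apply_ne_zero {k : ℕ} (p : CP k) : ∃ j, p.rep j ≠ 0 :=
  Function.ne_iff.1 p.rep_ne_zero

/-- The standard atlas of `ℂP^k`, made of the `k + 1` affine charts. -/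
instance instChartedSpace (k : ℕ) : ChartedSpace (Fin k → ℂ) (CP k) where
  atlas := Set.range chart
  chartAt p := chart p.exists_rep_apply_ne_zero.choose
  mem_chart_source p := p.exists_rep_apply_ne_zero.choose_spec
  chart_mem_atlas _ := Set.mem_range_self _

/-- `ℂP^k` is a smooth real manifold, modelled on `ℂ^k` as a real vector space. -/
instance instIsManifold (k : ℕ) : IsManifold 𝓘(ℝ, Fin k → ℂ) ∞ (CP k) := by
  refine isManifold_of_contDiffOn _ _ _ ?_
  rintro _ _ ⟨j, rfl⟩ ⟨l, rfl⟩
  have key : ∀ i : Fin (k + 1), ContDiff ℝ ∞ fun z : Fin k → ℂ =>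
      (j.insertNth (1 : ℂ) z : Fin (k + 1) → ℂ) i := by
    intro i
    rcases Fin.eq_self_or_eq_succAbove j i with rfl | ⟨i, rfl⟩
    · simpa using contDiff_const
    · simpa using contDiff_apply ℝ ℂ i
  have hf : ∀ z : Fin k → ℂ, ((chart j).symm.trans (chart l)) z = fun i =>
      (j.insertNth (1 : ℂ) z : Fin (k + 1) → ℂ) (l.succAbove i) /
        (j.insertNth (1 : ℂ) z : Fin (k + 1) → ℂ) l := fun z => affine_mk l _ _
  simp only [modelWithCornersSelf_coe, modelWithCornersSelf_coe_symm, Function.id_comp,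
    Function.comp_id, Set.preimage_id, Set.range_id, Set.inter_univ]
  have : ContDiffOn ℝ ∞ (fun z : Fin k → ℂ => fun i =>
      (j.insertNth (1 : ℂ) z : Fin (k + 1) → ℂ) (l.succAbove i) /
        (j.insertNth (1 : ℂ) z : Fin (k + 1) → ℂ) l)
      ((chart j).symm.trans (chart l)).source := by
    refine contDiffOn_pi.2 fun i => ?_
    simp only [div_eq_mul_inv]
    refine (key _).contDiffOn.mul ((key l).contDiffOn.inv fun z hz => ?_)
    rw [OpenPartialHomeomorph.trans_source] at hz
    exact (rep_mk_apply_ne_zero l _ _).1 hz.2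
  exact this.congr fun z _ => hf z

end CP

/-! ### The planar quasihomogeneous `n`-body problem -/

namespace NBody

/-- `n`-tuples of points of the plane `ℝ² = ℂ`. -/
abbrev Config (n : ℕ) : Type := EuclideanSpace ℂ (Fin n)

/-- The space `Ω` of the `n`-tuples with centre of mass at the origin. -/
def centered {n : ℕ} (m : Fin n → ℝ) : Submodule ℂ (Config n) where
  carrier := {r | ∑ i, m i • r i = 0}
  add_mem' {r s} hr hs := by
    simp only [Set.mem_ofPred_eq, PiLp.add_apply, smul_add, Finset.sum_add_distrib] at *
    rw [hr, hs, add_zero]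
  zero_mem' := by simp
  smul_mem' c r hr := by
    simp only [Set.mem_ofPred_eq, PiLp.smul_apply] at *
    simp only [smul_comm _ c, ← Finset.smul_sum, hr, smul_zero]

/-- The `n`-tuples in which two bodies collide. -/
def collision (n : ℕ) : Set (Config n) := {r | ∃ i j, i ≠ j ∧ r i = r j}

/-- The homogeneous potential `∑_{i<j} m_i m_j / ‖r_i - r_j‖^c`. -/
def powerPotential {n : ℕ} (m : Fin n → ℝ) (c : ℝ) (r : Config n) : ℝ :=
  ∑ i, ∑ j ∈ Finset.Ioi i, m i * m j / ‖r i - r j‖ ^ c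

/-- The quasihomogeneous potential `U = W + V`, with `W` of degree `-a` and `V` of degree `-b`. -/
def potential {n : ℕ} (m : Fin n → ℝ) (a b : ℝ) (r : Config n) : ℝ :=
  powerPotential m a r + powerPotential m b r

/-- The moment of inertia `I = ∑ m_i ‖r_i‖²`. -/
def inertia {n : ℕ} (m : Fin n → ℝ) (r : Config n) : ℝ := ∑ i, m i * ‖r i‖ ^ 2

/-- Central configurations: centered, without collisions, and `∇U(r) = σ ∇I(r)` for a constant
`σ`. -/
def IsCentral {n : ℕ} (m : Fin n → ℝ) (a b : ℝ) (r : Config n) : Prop :=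
  r ∈ centered m ∧ r ∉ collision n ∧ ∃ σ : ℝ, ∇ (potential m a b) r = σ • ∇ (inertia m) r

/-- The sphere of moment of inertia `I₀` in `Ω`, minus the collision set. -/
def sphereStar {n : ℕ} (m : Fin n → ℝ) (I₀ : ℝ) : Set (Config n) :=
  {r | r ∈ centered m ∧ r ∉ collision n ∧ inertia m r = I₀}

/-- Two configurations are equivalent if one is obtained from the other by a rotation of the
plane about the origin. -/
instance rotationSetoid {n : ℕ} (m : Fin n → ℝ) (I₀ : ℝ) : Setoid (sphereStar m I₀) where
  r r s := ∃ u : Circle, (s : Config n) = (u : ℂ) • (r : Config n)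
  iseqv :=
    { refl := fun r => ⟨1, by simp⟩
      symm := by
        rintro r s ⟨u, hu⟩
        exact ⟨u⁻¹, by rw [hu, smul_smul, ← Circle.coe_mul]; simp⟩
      trans := by
        rintro r s t ⟨u, hu⟩ ⟨w, hw⟩
        exact ⟨w * u, by rw [hw, hu, smul_smul, Circle.coe_mul]⟩ }

/-- The orbit space of the circle action on the sphere minus the collision set, with the quotient
topology. -/
abbrev OrbitSpace {n : ℕ} (m : Fin n → ℝ) (I₀ : ℝ) : Type := Quotient (rotationSetoid m I₀)

/-- The canonical projection onto the orbit space. -/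
def orbit {n : ℕ} {m : Fin n → ℝ} {I₀ : ℝ} (r : sphereStar m I₀) : OrbitSpace m I₀ :=
  Quotient.mk _ r

/-- The set of rotation classes of central configurations with moment of inertia `I₀`. -/
def centralClasses {n : ℕ} (m : Fin n → ℝ) (a b I₀ : ℝ) : Set (OrbitSpace m I₀) :=
  orbit '' {r | IsCentral m a b (r : Config n)}

/-- Smoothness of a map from a subset `S` of a normed space to a manifold: locally, the map
extends to a smooth map on an open set of the ambient space. -/
def SmoothOnSubset {E H M : Type*} [NormedAddCommGroup E] [NormedSpace ℝ E]
    [NormedAddCommGroup H] [NormedSpace ℝ H] [TopologicalSpace M] [ChartedSpace H M]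
    (S : Set E) (f : S → M) : Prop :=
  ∀ x : S, ∃ (W : Set E) (F : E → M), IsOpen W ∧ (x : E) ∈ W ∧
    ContMDiffOn 𝓘(ℝ, E) 𝓘(ℝ, H) ∞ F W ∧ ∀ y : S, (y : E) ∈ W → F y = f y

/-- The given charts make the orbit space the quotient manifold of the sphere minus the collision
set by the circle action: the orbit space is a smooth manifold and the canonical projection is a
smooth submersion, that is, it is smooth and has a smooth local section through every point.
There is at most one such smooth structure. -/
structure IsQuotientManifold {n : ℕ} (m : Fin n → ℝ) (I₀ : ℝ) (k : ℕ)
    [ChartedSpace (Fin k → ℂ) (OrbitSpace m I₀)] : Prop where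
  isManifold : IsManifold 𝓘(ℝ, Fin k → ℂ) ∞ (OrbitSpace m I₀)
  smooth_orbit : SmoothOnSubset (H := Fin k → ℂ) (sphereStar m I₀)
    (orbit : sphereStar m I₀ → OrbitSpace m I₀)
  exists_section : ∀ r : sphereStar m I₀, ∃ (N : Set (OrbitSpace m I₀))
    (s : OrbitSpace m I₀ → sphereStar m I₀), IsOpen N ∧ orbit r ∈ N ∧ s (orbit r) = r ∧
      (∀ q ∈ N, orbit (s q) = q) ∧
      ContMDiffOn 𝓘(ℝ, Fin k → ℂ) 𝓘(ℝ, Config n) ∞ (fun q => (s q : Config n)) N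

/-- The image `Δ̃` of the collision set in `ℂP^k`, for a linear identification `e` of `Ω` with
`ℂ^(k+1)`: the complex lines of nonzero configurations with collisions. -/
def projCollision {n : ℕ} {m : Fin n → ℝ} {k : ℕ}
    (e : centered m ≃ₗ[ℂ] (Fin (k + 1) → ℂ)) : Set (CP k) :=
  {p | ∃ (r : centered m) (hr : r ≠ 0), (r : Config n) ∈ collision n ∧
    CP.mk (e r) (e.map_ne_zero_iff.2 hr) = p}

theorem isClosed_collision (n : ℕ) : IsClosed (collision n) := by
  have : collision n = ⋃ i : Fin n, ⋃ j : Fin n, ⋃ _ : i ≠ j, {r : Config n | r i = r j} := by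
    ext r
    simp [collision]
  rw [this]
  refine isClosed_iUnion_of_finite fun i => isClosed_iUnion_of_finite fun j =>
    isClosed_iUnion_of_finite fun _ => ?_
  exact isClosed_eq (by fun_prop) (by fun_prop)

theorem smul_mem_collision {n : ℕ} (c : ℂ) {r : Config n} (hr : r ∈ collision n) :
    c • r ∈ collision n := by
  obtain ⟨i, j, hij, h⟩ := hr
  exact ⟨i, j, hij, by simp [h]⟩

theorem isClosed_projCollision {n : ℕ} {m : Fin n → ℝ} {k : ℕ}
    (e : centered m ≃ₗ[ℂ] (Fin (k + 1) → ℂ)) : IsClosed (projCollision e) := by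
  rw [← (CP.isQuotientMap_mk k).isClosed_preimage]
  have : (fun v : {v : Fin (k + 1) → ℂ // v ≠ 0} => CP.mk v.1 v.2) ⁻¹' projCollision e
      = {v | ((e.symm v.1 : centered m) : Config n) ∈ collision n} := by
    ext v
    constructor
    · rintro ⟨r, hr, hc, h⟩
      obtain ⟨c, hc'⟩ := (CP.mk_eq_mk_iff _ _ _ _).1 h.symm
      have : e.symm v.1 = c • r := by rw [← hc']; simp
      simp only [Set.mem_ofPred_eq, this, Submodule.coe_smul]
      exact smul_mem_collision c hc
    · intro h
      exact ⟨e.symm v.1, e.symm.map_ne_zero_iff.2 v.2, h, by simp⟩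
  rw [this]
  exact (isClosed_collision n).preimage (continuous_subtype_val.comp
    ((LinearMap.continuous_of_finiteDimensional e.symm.toLinearMap).comp continuous_subtype_val))

/-- `ℂP^k ∖ Δ̃`, an open subset of `ℂP^k`. -/
def projStar {n : ℕ} {m : Fin n → ℝ} {k : ℕ}
    (e : centered m ≃ₗ[ℂ] (Fin (k + 1) → ℂ)) : TopologicalSpace.Opens (CP k) :=
  ⟨(projCollision e)ᶜ, (isClosed_projCollision e).isOpen_compl⟩

/-- The potential induced on `ℂP^k ∖ Δ̃`: the value of `U` at a configuration of moment of inertia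
`I₀` on the complex line `p`. -/
def inducedPotential {n : ℕ} {m : Fin n → ℝ} {k : ℕ} (a b I₀ : ℝ)
    (e : centered m ≃ₗ[ℂ] (Fin (k + 1) → ℂ)) (p : projStar e) : ℝ :=
  potential m a b
    (Real.sqrt (I₀ / inertia m (e.symm (p : CP k).rep)) • (e.symm (p : CP k).rep : Config n))

/-- The set of critical points of a real function on a manifold modelled on `ℂ^k`. -/
def criticalSet (k : ℕ) {M : Type*} [TopologicalSpace M] [ChartedSpace (Fin k → ℂ) M]
    (f : M → ℝ) : Set M :=
  {p | MDifferentiableAt 𝓘(ℝ, Fin k → ℂ) 𝓘(ℝ, ℝ) f p ∧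
    mfderiv 𝓘(ℝ, Fin k → ℂ) 𝓘(ℝ, ℝ) f p = 0}

/-- `Ω` has complex dimension `n - 1`, so linear identifications with `ℂ^(n-1)` exist. -/
theorem nonempty_linearEquiv {n : ℕ} (hn : 2 ≤ n) (m : Fin n → ℝ) (hm : ∀ i, 0 < m i) :
    Nonempty (centered m ≃ₗ[ℂ] (Fin (n - 2 + 1) → ℂ)) := by
  let L : Config n →ₗ[ℂ] ℂ :=
    { toFun := fun r => ∑ i, m i • r i
      map_add' := fun r s => by simp [Finset.sum_add_distrib]
      map_smul' := fun c r => by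
        simp only [PiLp.smul_apply, smul_comm _ c, ← Finset.smul_sum, RingHom.id_apply] }
  have hk : LinearMap.ker L = centered m := rfl
  have hL : L ≠ 0 := by
    intro h
    have := LinearMap.congr_fun h (EuclideanSpace.single (⟨0, by omega⟩ : Fin n) (1 : ℂ))
    simp [L, PiLp.single_apply] at this
    exact (hm _).ne' this
  have hr : LinearMap.range L = ⊤ := LinearMap.range_eq_top.2 (LinearMap.surjective hL)
  have := LinearMap.finrank_range_add_finrank_ker L
  rw [hr, hk, finrank_top, Module.finrank_self, finrank_euclideanSpace_fin] at this
  refine ⟨LinearEquiv.ofFinrankEq _ _ ?_⟩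
  rw [Module.finrank_fin_fun]
  omega

end NBody

end

/-! Rescaling a nonzero configuration to moment of inertia `I₀` absorbs the modulus of any nonzero
complex factor and leaves only its phase, which is a rotation. Hence two points of the sphere lie on
the same complex line exactly when they are in the same circle orbit, and the orbit space is in
bijection with the collision-free lines (`orbitEquiv`).

Smoothness comes from local sections. In homogeneous coordinates the induced potential becomes
`homogeneousPotential`, which is `U` after normalization and is invariant under nonzero complex
scaling. Composing it with smooth local sections of the projection to projective space shows that
`Ũ` is smooth. The chain rule, used once along the projection and once along a section, identifies
critical lines with critical vectors (`mfderiv_inducedPotential_eq_zero_iff`).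

At a point with `I = I₀`, the derivative of normalization is `h - (dI(h) / (2 I₀)) r`, so
criticality on `Ω` says that `dU` and `dI` are proportional there, with factor `dU(r) / (2 I₀)`.
Both differentials vanish on translations, so proportionality on `Ω` is the same as proportionality
on all `n`-tuples, which is centrality (`isCentral_iff_fderiv_comp_normalize`).

A quotient structure exists by transport along `orbitHomeomorph`. For an arbitrary one, smoothness
of the projection and its local sections make the same bijection a diffeomorphism
(`orbitDiffeomorph`). -/

namespace CP

/-! ### Smoothness and local sections of the projection to projective space -/

variable {k : ℕ}

/-- The complex line spanned by `v`, with a junk value at `v = 0`. -/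
noncomputable def line (v : Fin (k + 1) → ℂ) : CP k :=
  open Classical in if h : v ≠ 0 then mk v h else mk 1 one_ne_zero

theorem line_of_ne_zero {v : Fin (k + 1) → ℂ} (hv : v ≠ 0) : line v = mk v hv := by
  simp [line, hv]

theorem chart_mem_maximalAtlas (j : Fin (k + 1)) :
    chart j ∈ IsManifold.maximalAtlas 𝓘(ℝ, Fin k → ℂ) ∞ (CP k) :=
  IsManifold.subset_maximalAtlas ⟨j, rfl⟩

theorem contDiff_insertNth (j : Fin (k + 1)) :
    ContDiff ℝ ∞ fun z : Fin k → ℂ => (j.insertNth (1 : ℂ) z : Fin (k + 1) → ℂ) := by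
  refine contDiff_pi.2 fun i => ?_
  rcases Fin.eq_self_or_eq_succAbove j i with rfl | ⟨i, rfl⟩
  · simpa using contDiff_const
  · simpa using contDiff_apply ℝ ℂ i

/-- Where a coordinate `v j` is nonzero, the projection is the quotient map `w ↦ (w i / w j)`
followed by the inverse of the chart `j`. -/
theorem contMDiffAt_line {v : Fin (k + 1) → ℂ} (hv : v ≠ 0) :
    ContMDiffAt 𝓘(ℝ, Fin (k + 1) → ℂ) 𝓘(ℝ, Fin k → ℂ) ∞ line v := by
  obtain ⟨j, hj⟩ := Function.ne_iff.1 hv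
  have hj : v j ≠ 0 := hj
  have h₁ : ContMDiffAt 𝓘(ℝ, Fin (k + 1) → ℂ) 𝓘(ℝ, Fin k → ℂ) ∞
      (fun w : Fin (k + 1) → ℂ => fun i => w (j.succAbove i) / w j) v := by
    refine ContDiffAt.contMDiffAt (contDiffAt_pi.2 fun i => ?_)
    simp only [div_eq_mul_inv]
    exact (contDiff_apply ℝ ℂ _).contDiffAt.mul ((contDiff_apply ℝ ℂ j).contDiffAt.inv hj)
  have h₂ := contMDiffAt_symm_of_mem_maximalAtlas (I := 𝓘(ℝ, Fin k → ℂ))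
    (chart_mem_maximalAtlas j) (x := fun i => v (j.succAbove i) / v j) (Set.mem_univ _)
  refine (h₂.comp v h₁).congr_of_eventuallyEq ?_
  filter_upwards [(isOpen_ne_fun (continuous_apply j) continuous_const).mem_nhds hj] with w hw
  have hw : w j ≠ 0 := hw
  have hw0 : w ≠ 0 := fun h => hw (by simp [h])
  rw [line_of_ne_zero hw0]
  have := (chart j).left_inv ((rep_mk_apply_ne_zero j w hw0).2 hw)
  rw [← this]
  exact congrArg (chart j).symm (affine_mk j w hw0)

/-- On the chart domain `z_j ≠ 0`, the homogeneous coordinates whose `j`-th entry is `c`. -/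
noncomputable def lift (j : Fin (k + 1)) (c : ℂ) (p : CP k) : Fin (k + 1) → ℂ :=
  c • (j.insertNth (1 : ℂ) (affine j p) : Fin (k + 1) → ℂ)

theorem lift_ne_zero (j : Fin (k + 1)) {c : ℂ} (hc : c ≠ 0) (p : CP k) : lift j c p ≠ 0 :=
  smul_ne_zero hc (insertNth_ne_zero j _)

theorem mk_lift (j : Fin (k + 1)) {c : ℂ} (hc : c ≠ 0) {p : CP k} (hp : p.rep j ≠ 0) :
    mk (lift j c p) (lift_ne_zero j hc p) = p := by
  conv_rhs => rw [← (chart j).left_inv hp]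
  exact (mk_eq_mk_iff _ _ _ (insertNth_ne_zero j _)).2 ⟨c, rfl⟩

/-- The scale `c = v j` makes the section pass through `v` itself rather than through a multiple of
it. -/
theorem lift_mk {j : Fin (k + 1)} {v : Fin (k + 1) → ℂ} (hv : v ≠ 0) (hj : v j ≠ 0) :
    lift j (v j) (mk v hv) = v := by
  funext i
  rw [lift, affine_mk]
  rcases Fin.eq_self_or_eq_succAbove j i with rfl | ⟨i, rfl⟩
  · simp
  · simp [mul_div_cancel₀ _ hj]

theorem contMDiffOn_lift (j : Fin (k + 1)) (c : ℂ) :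
    ContMDiffOn 𝓘(ℝ, Fin k → ℂ) 𝓘(ℝ, Fin (k + 1) → ℂ) ∞ (lift j c) {p | p.rep j ≠ 0} := by
  have h₁ := contMDiffOn_of_mem_maximalAtlas (I := 𝓘(ℝ, Fin k → ℂ)) (chart_mem_maximalAtlas j)
  have h₂ : ContDiff ℝ ∞
      fun z : Fin k → ℂ => c • (j.insertNth (1 : ℂ) z : Fin (k + 1) → ℂ) :=
    (contDiff_insertNth j).const_smul c
  exact h₂.contMDiff.comp_contMDiffOn h₁

/-- Through every nonzero vector `v` there is a smooth local section of the projection. -/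
theorem exists_local_section (v : Fin (k + 1) → ℂ) (hv : v ≠ 0) :
    ∃ (S : Set (CP k)) (σ : CP k → Fin (k + 1) → ℂ), IsOpen S ∧ mk v hv ∈ S ∧ σ (mk v hv) = v ∧
      (∀ p ∈ S, ∃ h : σ p ≠ 0, mk (σ p) h = p) ∧
      ContMDiffOn 𝓘(ℝ, Fin k → ℂ) 𝓘(ℝ, Fin (k + 1) → ℂ) ∞ σ S := by
  obtain ⟨j, hj⟩ := Function.ne_iff.1 hv
  exact ⟨_, lift j (v j), isOpen_chart_source j, (rep_mk_apply_ne_zero j v hv).2 hj,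
    lift_mk hv hj, fun p hp => ⟨lift_ne_zero j hj p, mk_lift j hj hp⟩, contMDiffOn_lift j (v j)⟩

end CP

/-! ### Scaling, rotation and normalization of configurations -/

namespace NBody

variable {n : ℕ}

theorem real_smul_eq (t : ℝ) (r : Config n) : t • r = (t : ℂ) • r := by
  ext i
  simp

theorem inertia_smul (m : Fin n → ℝ) (c : ℂ) (r : Config n) :
    inertia m (c • r) = ‖c‖ ^ 2 * inertia m r := by
  simp only [inertia, PiLp.smul_apply, smul_eq_mul, norm_mul, mul_pow, Finset.mul_sum]
  exact Finset.sum_congr rfl fun i _ => by ring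

theorem inertia_pos {m : Fin n → ℝ} (hm : ∀ i, 0 < m i) {r : Config n} (hr : r ≠ 0) :
    0 < inertia m r := by
  obtain ⟨i, hi⟩ : ∃ i, r i ≠ 0 := by
    by_contra! h
    exact hr (by ext i; simpa using h i)
  refine Finset.sum_pos' (fun j _ => mul_nonneg (hm j).le (sq_nonneg _)) ⟨i, Finset.mem_univ i, ?_⟩
  exact mul_pos (hm i) (pow_pos (norm_pos_iff.2 hi) 2)

theorem zero_mem_collision (hn : 2 ≤ n) : (0 : Config n) ∈ collision n :=
  ⟨⟨0, by omega⟩, ⟨1, by omega⟩, by simp, rfl⟩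

theorem ne_zero_of_notMem_collision (hn : 2 ≤ n) {r : Config n} (hr : r ∉ collision n) : r ≠ 0 := by
  rintro rfl
  exact hr (zero_mem_collision hn)

theorem smul_mem_collision_iff {c : ℂ} (hc : c ≠ 0) {r : Config n} :
    c • r ∈ collision n ↔ r ∈ collision n := by
  refine ⟨fun h => ?_, smul_mem_collision c⟩
  simpa [smul_smul, hc] using smul_mem_collision c⁻¹ h

/-- The rescaling of `r` to moment of inertia `I₀`. -/
noncomputable def normalize (m : Fin n → ℝ) (I₀ : ℝ) (r : Config n) : Config n :=
  Real.sqrt (I₀ / inertia m r) • r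

section normalize

variable {m : Fin n → ℝ} {I₀ : ℝ}

theorem normalize_of_inertia_eq (hI₀ : 0 < I₀) {r : Config n} (hr : inertia m r = I₀) :
    normalize m I₀ r = r := by
  simp [normalize, hr, hI₀.ne']

theorem inertia_normalize (hm : ∀ i, 0 < m i) (hI₀ : 0 < I₀) {r : Config n} (hr : r ≠ 0) :
    inertia m (normalize m I₀ r) = I₀ := by
  have h := inertia_pos hm hr
  rw [normalize, real_smul_eq, inertia_smul, Complex.norm_real, Real.norm_eq_abs, sq_abs,
    Real.sq_sqrt (by positivity), div_mul_cancel₀ _ h.ne']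

theorem normalize_eq_smul (m : Fin n → ℝ) (I₀ : ℝ) (r : Config n) :
    normalize m I₀ r = (Real.sqrt (I₀ / inertia m r) : ℂ) • r := real_smul_eq _ _

theorem sqrt_inertia_ne_zero (hm : ∀ i, 0 < m i) (hI₀ : 0 < I₀) {r : Config n} (hr : r ≠ 0) :
    (Real.sqrt (I₀ / inertia m r) : ℂ) ≠ 0 := by
  have h := inertia_pos hm hr
  have : 0 < Real.sqrt (I₀ / inertia m r) := by positivity
  exact_mod_cast this.ne'

theorem normalize_mem_sphereStar (hn : 2 ≤ n) (hm : ∀ i, 0 < m i) (hI₀ : 0 < I₀) {r : Config n}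
    (hr : r ∈ centered m) (hc : r ∉ collision n) : normalize m I₀ r ∈ sphereStar m I₀ := by
  have h0 := ne_zero_of_notMem_collision hn hc
  refine ⟨?_, ?_, inertia_normalize hm hI₀ h0⟩
  · rw [normalize_eq_smul]
    exact (centered m).smul_mem _ hr
  · rwa [normalize_eq_smul, smul_mem_collision_iff (sqrt_inertia_ne_zero hm hI₀ h0)]

/-- Since `I` is quadratic, normalization divides by `‖c‖` and the phase `c / ‖c‖` remains. This
turns equality of complex lines into equality of circle orbits. -/
theorem exists_circle_normalize_smul (m : Fin n → ℝ) (I₀ : ℝ) {c : ℂ} (hc : c ≠ 0) (r : Config n) :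
    ∃ u : Circle, normalize m I₀ (c • r) = (u : ℂ) • normalize m I₀ r := by
  have hc' : ‖c‖ ≠ 0 := norm_ne_zero_iff.2 hc
  refine ⟨⟨c / ‖c‖, ?_⟩, ?_⟩
  · simp [Submonoid.unitSphere, hc']
  · have : Real.sqrt (I₀ / (‖c‖ ^ 2 * inertia m r)) = ‖c‖⁻¹ * Real.sqrt (I₀ / inertia m r) := by
      rw [← div_div, div_right_comm, div_eq_mul_inv _ (‖c‖ ^ 2), mul_comm,
        Real.sqrt_mul (by positivity), Real.sqrt_inv, Real.sqrt_sq (norm_nonneg _)]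
    rw [normalize_eq_smul, normalize_eq_smul, inertia_smul, this, smul_smul, smul_smul]
    congr 1
    push_cast
    field_simp

end normalize

/-! ### Symmetries and smoothness of the potential -/

section potential

theorem powerPotential_smul (m : Fin n → ℝ) (c : ℝ) (u : Circle) (r : Config n) :
    powerPotential m c ((u : ℂ) • r) = powerPotential m c r := by
  simp only [powerPotential, PiLp.smul_apply, ← smul_sub, norm_smul, Circle.norm_coe, one_mul]

theorem potential_smul (m : Fin n → ℝ) (a b : ℝ) (u : Circle) (r : Config n) :
    potential m a b ((u : ℂ) • r) = potential m a b r := by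
  simp only [potential, powerPotential_smul]

theorem potential_normalize_smul (m : Fin n → ℝ) (I₀ a b : ℝ) {c : ℂ}
    (hc : c ≠ 0) (r : Config n) :
    potential m a b (normalize m I₀ (c • r)) = potential m a b (normalize m I₀ r) := by
  obtain ⟨u, hu⟩ := exists_circle_normalize_smul m I₀ hc r
  rw [hu, potential_smul]

/-- The configuration with all bodies at the point `c`. -/
def diagonal (n : ℕ) (c : ℂ) : Config n := WithLp.toLp 2 fun _ => c

@[simp]
theorem diagonal_apply (c : ℂ) (i : Fin n) : diagonal n c i = c := rfl

theorem potential_add_diagonal (m : Fin n → ℝ) (a b : ℝ) (r : Config n) (c : ℂ) :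
    potential m a b (r + diagonal n c) = potential m a b r := by
  simp [potential, powerPotential]

theorem contDiffAt_apply (i : Fin n) (r : Config n) : ContDiffAt ℝ ∞ (fun s : Config n => s i) r :=
  (EuclideanSpace.proj (𝕜 := ℂ) i : Config n →L[ℂ] ℂ).restrictScalars ℝ |>.contDiff.contDiffAt

theorem contDiffAt_powerPotential (m : Fin n → ℝ) (c : ℝ) {r : Config n} (hr : r ∉ collision n) :
    ContDiffAt ℝ ∞ (powerPotential m c) r := by
  refine ContDiffAt.sum fun i _ => ContDiffAt.sum fun j hj => ?_
  have hij : r i - r j ≠ 0 := fun h =>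
    hr ⟨i, j, (Finset.mem_Ioi.1 hj).ne, sub_eq_zero.1 h⟩
  have hd : ContDiffAt ℝ ∞ (fun s : Config n => ‖s i - s j‖) r :=
    ((contDiffAt_apply i r).sub (contDiffAt_apply j r)).norm ℝ hij
  exact contDiffAt_const.div (hd.rpow_const_of_ne (norm_ne_zero_iff.2 hij))
    (Real.rpow_pos_of_pos (norm_pos_iff.2 hij) c).ne'

theorem contDiffAt_potential (m : Fin n → ℝ) (a b : ℝ) {r : Config n} (hr : r ∉ collision n) :
    ContDiffAt ℝ ∞ (potential m a b) r :=
  (contDiffAt_powerPotential m a hr).add (contDiffAt_powerPotential m b hr)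

end potential

/-! ### Differential of the moment of inertia -/

section inertia

theorem contDiffAt_inertia (m : Fin n → ℝ) (r : Config n) : ContDiffAt ℝ ∞ (inertia m) r :=
  ContDiffAt.sum fun i _ => contDiffAt_const.mul ((contDiffAt_apply i r).norm_sq ℝ)

theorem fderiv_inertia_apply (m : Fin n → ℝ) (r h : Config n) :
    fderiv ℝ (inertia m) r h = 2 * ∑ i, m i * inner ℝ (r i) (h i) := by
  have hp : ∀ i, HasFDerivAt (fun s : Config n => s i)
      ((EuclideanSpace.proj (𝕜 := ℂ) i : Config n →L[ℂ] ℂ).restrictScalars ℝ) r := fun i =>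
    ((EuclideanSpace.proj (𝕜 := ℂ) i : Config n →L[ℂ] ℂ).restrictScalars ℝ).hasFDerivAt
  have : HasFDerivAt (inertia m) _ r :=
    HasFDerivAt.fun_sum fun i (_ : i ∈ Finset.univ) => ((hp i).norm_sq.const_mul (m i))
  rw [this.fderiv, Finset.mul_sum]
  simp only [sum_apply]
  refine Finset.sum_congr rfl fun i _ => ?_
  simp
  ring

/-- Euler's identity in degree 2; it determines the multiplier of a central configuration. -/
theorem fderiv_inertia_self (m : Fin n → ℝ) (r : Config n) :
    fderiv ℝ (inertia m) r r = 2 * inertia m r := by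
  simp [fderiv_inertia_apply, inertia]

theorem fderiv_inertia_diagonal {m : Fin n → ℝ} {r : Config n} (hr : r ∈ centered m) (c : ℂ) :
    fderiv ℝ (inertia m) r (diagonal n c) = 0 := by
  have hr : ∑ i, m i • r i = 0 := hr
  have : ∑ i, m i * inner ℝ (r i) c = inner ℝ (∑ i, m i • r i) c := by
    simp only [sum_inner, real_inner_smul_left]
  simp only [fderiv_inertia_apply, diagonal_apply, this, hr, inner_zero_left, mul_zero]

end inertia

/-- `U` depends only on mutual differences, so it is constant along the line `r + t • diagonal n c`.
-/
theorem fderiv_potential_diagonal (m : Fin n → ℝ) (a b : ℝ) {r : Config n}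
    (hr : r ∉ collision n) (c : ℂ) : fderiv ℝ (potential m a b) r (diagonal n c) = 0 := by
  have hU : HasFDerivAt (potential m a b) (fderiv ℝ (potential m a b) r)
      (r + (0 : ℝ) • diagonal n c) := by
    simpa using ((contDiffAt_potential m a b hr).differentiableAt (by simp)).hasFDerivAt
  have hl : HasDerivAt (fun t : ℝ => r + t • diagonal n c) (diagonal n c) 0 := by
    simpa using ((hasDerivAt_id (0 : ℝ)).smul_const (diagonal n c)).const_add r
  have h := hU.comp_hasDerivAt (0 : ℝ) hl
  have hc : potential m a b ∘ (fun t : ℝ => r + t • diagonal n c)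
      = fun _ => potential m a b r := by
    funext t
    have : t • diagonal n c = diagonal n (t • c) := rfl
    simp only [Function.comp_apply, this, potential_add_diagonal]
  rw [hc] at h
  exact h.unique (hasDerivAt_const _ _)

/-- A configuration is the sum of a centered one and of a translation. -/
theorem exists_sub_diagonal_mem_centered (hn : 2 ≤ n) {m : Fin n → ℝ} (hm : ∀ i, 0 < m i)
    (h : Config n) : ∃ c, h - diagonal n c ∈ centered m := by
  have hM : (∑ i, m i) ≠ 0 :=
    (Finset.sum_pos (fun i _ => hm i) ⟨⟨0, by omega⟩, Finset.mem_univ _⟩).ne'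
  refine ⟨(∑ i, m i)⁻¹ • ∑ i, m i • h i, ?_⟩
  change ∑ i, m i • (h i - (∑ i, m i)⁻¹ • ∑ i, m i • h i) = 0
  simp only [smul_sub, Finset.sum_sub_distrib]
  rw [← Finset.sum_smul, smul_smul, mul_inv_cancel₀ hM, one_smul, sub_self]

theorem isCentral_iff_fderiv {m : Fin n → ℝ} {a b : ℝ} {r : Config n} :
    IsCentral m a b r ↔ r ∈ centered m ∧ r ∉ collision n ∧
      ∃ σ : ℝ, fderiv ℝ (potential m a b) r = σ • fderiv ℝ (inertia m) r := by
  refine and_congr_right fun _ => and_congr_right fun _ => exists_congr fun σ => ?_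
  have : σ • ∇ (inertia m) r
      = (InnerProductSpace.toDual ℝ (Config n)).symm (σ • fderiv ℝ (inertia m) r) := by
    simp [gradient]
  rw [this]
  exact (InnerProductSpace.toDual ℝ (Config n)).symm.injective.eq_iff

/-! ### Central configurations as critical points of the rescaled potential -/

section criterion

variable {m : Fin n → ℝ} {I₀ : ℝ}

theorem contDiffAt_normalize (hm : ∀ i, 0 < m i) (hI₀ : 0 < I₀) {r : Config n} (hr : r ≠ 0) :
    ContDiffAt ℝ ∞ (normalize m I₀) r := by
  have h := inertia_pos hm hr
  exact ((contDiffAt_const.div (contDiffAt_inertia m r) h.ne').sqrt (div_pos hI₀ h).ne').smul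
    contDiffAt_id

/-- The factor `√(I₀ / I)` equals 1 at `r` and has differential `-dI / (2 I₀)` there. The result is
the projection along `r` onto the kernel of `dI`. -/
theorem fderiv_normalize_apply (hI₀ : 0 < I₀) {r : Config n} (hr : inertia m r = I₀)
    (h : Config n) :
    fderiv ℝ (normalize m I₀) r h = h - (fderiv ℝ (inertia m) r h / (2 * I₀)) • r := by
  have hI : HasFDerivAt (inertia m) (fderiv ℝ (inertia m) r) r :=
    ((contDiffAt_inertia m r).differentiableAt (by simp)).hasFDerivAt
  have hρ : HasFDerivAt (fun s => Real.sqrt (I₀ * (inertia m s)⁻¹)) _ r :=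
    (((hasDerivAt_inv (hr ▸ hI₀.ne')).comp_hasFDerivAt r hI).const_mul I₀).sqrt
      (by simp [hr, hI₀.ne'])
  have hN : HasFDerivAt (normalize m I₀) _ r := hρ.smul (hasFDerivAt_id r)
  rw [hN.fderiv]
  simp [hr, hI₀.ne', sub_eq_add_neg, ← neg_smul]
  congr 1
  field_simp

/-- A normalized configuration is central if and only if it is critical for the potential made
invariant under rescaling. -/
theorem isCentral_iff_fderiv_comp_normalize (hn : 2 ≤ n) (hm : ∀ i, 0 < m i) (hI₀ : 0 < I₀)
    (a b : ℝ) {r : Config n} (hr : r ∈ sphereStar m I₀) :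
    IsCentral m a b r ↔
      ∀ h ∈ centered m, fderiv ℝ (fun s => potential m a b (normalize m I₀ s)) r h = 0 := by
  obtain ⟨hr₁, hr₂, hr₃⟩ := hr
  have hN := normalize_of_inertia_eq hI₀ hr₃
  have key : ∀ h, fderiv ℝ (fun s => potential m a b (normalize m I₀ s)) r h
      = fderiv ℝ (potential m a b) r h
        - fderiv ℝ (potential m a b) r r / (2 * I₀) * fderiv ℝ (inertia m) r h := by
    intro h
    have h₁ : HasFDerivAt (potential m a b) (fderiv ℝ (potential m a b) r)
        (normalize m I₀ r) := by
      rw [hN]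
      exact ((contDiffAt_potential m a b hr₂).differentiableAt (by simp)).hasFDerivAt
    have h₂ := ((contDiffAt_normalize hm hI₀ (ne_zero_of_notMem_collision hn hr₂)).differentiableAt
      (by simp)).hasFDerivAt
    have h₃ : HasFDerivAt (fun s => potential m a b (normalize m I₀ s)) _ r := h₁.comp r h₂
    rw [h₃.fderiv, ContinuousLinearMap.comp_apply, fderiv_normalize_apply hI₀ hr₃,
      map_sub, map_smul, smul_eq_mul]
    ring
  rw [isCentral_iff_fderiv]
  constructor
  -- By Euler's identity `dU(r) = σ dI(r) = 2 σ I₀`, so the correction term in `key` cancels `σ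
  -- dI(h)`.
  · rintro ⟨-, -, σ, hσ⟩ h -
    rw [key, hσ]
    simp only [smul_apply, smul_eq_mul, fderiv_inertia_self, hr₃]
    field_simp
    ring
  · intro H
    -- The multiplier is forced by evaluating `dU = σ dI` in the direction `r`.
    refine ⟨hr₁, hr₂, fderiv ℝ (potential m a b) r r / (2 * I₀), ?_⟩
    ext h
    -- The gradients are those of the full space of `n`-tuples, whereas `H` covers only centered
    -- directions; the missing ones are translations, on which both differentials vanish.
    obtain ⟨c, hc⟩ := exists_sub_diagonal_mem_centered hn hm h
    have := (key _).symm.trans (H _ hc)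
    rw [map_sub, map_sub, fderiv_potential_diagonal m a b hr₂, fderiv_inertia_diagonal hr₁] at this
    rw [smul_apply, smul_eq_mul]
    linarith

end criterion

end NBody

/-! ### Homogeneous coordinates and the induced potential -/

namespace NBody

variable {n k : ℕ} {m : Fin n → ℝ} {I₀ : ℝ} (e : centered m ≃ₗ[ℂ] (Fin (k + 1) → ℂ))

/-- The parametrization of the centered configurations by `ℂ^(k+1)`. -/
noncomputable def param : (Fin (k + 1) → ℂ) →L[ℝ] Config n :=
  LinearMap.toContinuousLinearMap
    (((centered m).subtype ∘ₗ e.symm.toLinearMap).restrictScalars ℝ)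

theorem param_apply (v : Fin (k + 1) → ℂ) : param e v = (e.symm v : Config n) := rfl

theorem param_mem (v : Fin (k + 1) → ℂ) : param e v ∈ centered m := (e.symm v).2

theorem param_smul (c : ℂ) (v : Fin (k + 1) → ℂ) : param e (c • v) = c • param e v := by
  simp [param_apply]

theorem param_coord {r : Config n} (hr : r ∈ centered m) : param e (e ⟨r, hr⟩) = r := by
  simp [param_apply]

/-- Smoothness on the sphere is tested by extensions to open sets of the ambient space, while `e`
lives only on `Ω`. -/
theorem exists_coord_extension : ∃ E : Config n →L[ℝ] (Fin (k + 1) → ℂ),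
    ∀ r (hr : r ∈ centered m), E r = e ⟨r, hr⟩ := by
  obtain ⟨E, hE⟩ := e.toLinearMap.exists_extend
  exact ⟨LinearMap.toContinuousLinearMap (E.restrictScalars ℝ),
    fun r hr => LinearMap.congr_fun hE ⟨r, hr⟩⟩

theorem mk_mem_projStar_iff {v : Fin (k + 1) → ℂ} (hv : v ≠ 0) :
    CP.mk v hv ∈ projStar e ↔ param e v ∉ collision n := by
  refine not_congr ⟨?_, fun h => ?_⟩
  · rintro ⟨r, hr, hc, h⟩
    obtain ⟨c, hc'⟩ := (CP.mk_eq_mk_iff _ _ _ _).1 h.symm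
    rw [← hc', param_smul, param_apply, e.symm_apply_apply]
    exact smul_mem_collision c hc
  · exact ⟨e.symm v, e.symm.map_ne_zero_iff.2 hv, h, by simp⟩

theorem param_notMem_collision {p : CP k} (hp : p ∈ projStar e) {v : Fin (k + 1) → ℂ}
    (hv : v ≠ 0) (h : CP.mk v hv = p) : param e v ∉ collision n :=
  (mk_mem_projStar_iff e hv).1 (h ▸ hp)

theorem ne_zero_of_param_notMem (hn : 2 ≤ n) {v : Fin (k + 1) → ℂ}
    (h : param e v ∉ collision n) : v ≠ 0 := by
  rintro rfl
  exact h (by simpa using zero_mem_collision hn)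

/-- The potential in homogeneous coordinates. -/
noncomputable def homogeneousPotential (a b I₀ : ℝ) (v : Fin (k + 1) → ℂ) : ℝ :=
  potential m a b (normalize m I₀ (param e v))

theorem homogeneousPotential_smul (a b I₀ : ℝ) {c : ℂ} (hc : c ≠ 0) (v : Fin (k + 1) → ℂ) :
    homogeneousPotential e a b I₀ (c • v) = homogeneousPotential e a b I₀ v := by
  simp only [homogeneousPotential, param_smul, potential_normalize_smul m I₀ a b hc]

/-- Scale invariance replaces the arbitrary choice `rep` by any homogeneous coordinates, in
particular by smoothly varying ones. -/
theorem inducedPotential_eq (a b I₀ : ℝ) (p : projStar e) {v : Fin (k + 1) → ℂ} (hv : v ≠ 0)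
    (h : CP.mk v hv = p) : inducedPotential a b I₀ e p = homogeneousPotential e a b I₀ v := by
  obtain ⟨c, hc, hr⟩ := CP.rep_mk v hv
  rw [← homogeneousPotential_smul e a b I₀ hc v, ← hr, h]
  rfl

theorem contDiffAt_normalize_param (hn : 2 ≤ n) (hm : ∀ i, 0 < m i) (hI₀ : 0 < I₀)
    {v : Fin (k + 1) → ℂ} (hv : param e v ∉ collision n) :
    ContDiffAt ℝ ∞ (fun w => normalize m I₀ (param e w)) v :=
  (contDiffAt_normalize hm hI₀ (ne_zero_of_notMem_collision hn hv)).comp v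
    (param e).contDiff.contDiffAt

theorem contDiffAt_homogeneousPotential (hn : 2 ≤ n) (hm : ∀ i, 0 < m i) (hI₀ : 0 < I₀)
    (a b : ℝ) {v : Fin (k + 1) → ℂ} (hv : param e v ∉ collision n) :
    ContDiffAt ℝ ∞ (homogeneousPotential e a b I₀) v :=
  (contDiffAt_potential m a b
    (normalize_mem_sphereStar hn hm hI₀ (param_mem e v) hv).2.1).comp v
    (contDiffAt_normalize_param e hn hm hI₀ hv)

/-- Smooth local homogeneous coordinates on the projective space minus the collision set, with a
prescribed value at one point. -/
theorem exists_local_section_projStar {v : Fin (k + 1) → ℂ} (hv : v ≠ 0) {p : projStar e}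
    (hp : CP.mk v hv = p) :
    ∃ (S : Set (projStar e)) (σ : projStar e → Fin (k + 1) → ℂ), IsOpen S ∧ p ∈ S ∧ σ p = v ∧
      (∀ q ∈ S, ∃ h : σ q ≠ 0, CP.mk (σ q) h = q) ∧
      ContMDiffOn 𝓘(ℝ, Fin k → ℂ) 𝓘(ℝ, Fin (k + 1) → ℂ) ∞ σ S := by
  obtain ⟨S, σ, hS, hpS, hσ, hmk, hsm⟩ := CP.exists_local_section v hv
  rw [hp] at hpS hσ
  exact ⟨Subtype.val ⁻¹' S, fun q => σ q, hS.preimage continuous_subtype_val, hpS, hσ,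
    fun q hq => hmk q hq, hsm.comp contMDiff_subtype_val.contMDiffOn fun _ h => h⟩

/-- The complex line spanned by `v`, with the junk value `p₀` if it is a line of collisions. -/
noncomputable def lineStar (p₀ : projStar e) (v : Fin (k + 1) → ℂ) : projStar e :=
  open Classical in if h : CP.line v ∈ projStar e then ⟨CP.line v, h⟩ else p₀

theorem coe_lineStar (hn : 2 ≤ n) (p₀ : projStar e) {v : Fin (k + 1) → ℂ}
    (h : param e v ∉ collision n) :
    (lineStar e p₀ v : CP k) = CP.mk v (ne_zero_of_param_notMem e hn h) := by
  have hv := ne_zero_of_param_notMem e hn h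
  have : CP.line v ∈ projStar e := by
    rwa [CP.line_of_ne_zero hv, mk_mem_projStar_iff]
  rw [lineStar, dif_pos this]
  exact CP.line_of_ne_zero hv

theorem isOpen_param_notMem : IsOpen {v | param e v ∉ collision n} :=
  (isClosed_collision n).isOpen_compl.preimage (param e).continuous

theorem contMDiffAt_lineStar (hn : 2 ≤ n) (p₀ : projStar e) {v : Fin (k + 1) → ℂ}
    (h : param e v ∉ collision n) :
    ContMDiffAt 𝓘(ℝ, Fin (k + 1) → ℂ) 𝓘(ℝ, Fin k → ℂ) ∞ (lineStar e p₀) v := by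
  rw [← ContMDiffAt.subtypeVal_comp_iff]
  refine (CP.contMDiffAt_line (ne_zero_of_param_notMem e hn h)).congr_of_eventuallyEq ?_
  filter_upwards [(isOpen_param_notMem e).mem_nhds h] with w hw
  rw [Function.comp_apply, coe_lineStar e hn p₀ hw, CP.line_of_ne_zero]

theorem exists_section_eventuallyEq (a b I₀ : ℝ) {v : Fin (k + 1) → ℂ} (hv : v ≠ 0)
    {p : projStar e} (hp : CP.mk v hv = p) :
    ∃ σ : projStar e → Fin (k + 1) → ℂ, σ p = v ∧
      ContMDiffAt 𝓘(ℝ, Fin k → ℂ) 𝓘(ℝ, Fin (k + 1) → ℂ) ∞ σ p ∧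
      inducedPotential a b I₀ e =ᶠ[nhds p] homogeneousPotential e a b I₀ ∘ σ := by
  obtain ⟨S, σ, hS, hpS, hσ, hmk, hsm⟩ := exists_local_section_projStar e hv hp
  refine ⟨σ, hσ, hsm.contMDiffAt (hS.mem_nhds hpS), ?_⟩
  filter_upwards [hS.mem_nhds hpS] with q hq
  obtain ⟨h, hq⟩ := hmk q hq
  exact inducedPotential_eq e a b I₀ q h hq

theorem contMDiff_inducedPotential (hn : 2 ≤ n) (hm : ∀ i, 0 < m i) (hI₀ : 0 < I₀) (a b : ℝ) :
    ContMDiff 𝓘(ℝ, Fin k → ℂ) 𝓘(ℝ, ℝ) ∞ (inducedPotential a b I₀ e) := by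
  intro p
  have hp := CP.mk_rep (p : CP k)
  obtain ⟨σ, hσ, hsm, heq⟩ := exists_section_eventuallyEq e a b I₀ _ hp
  have h := param_notMem_collision e p.2 _ hp
  rw [← hσ] at h
  exact ((contDiffAt_homogeneousPotential e hn hm hI₀ a b h).contMDiffAt.comp p
    hsm).congr_of_eventuallyEq heq

theorem mfderiv_eq_zero_of_eventuallyEq_comp {E H E' H' : Type*} [NormedAddCommGroup E]
    [NormedSpace ℝ E] [TopologicalSpace H] {I : ModelWithCorners ℝ E H} [NormedAddCommGroup E']
    [NormedSpace ℝ E'] [TopologicalSpace H'] {I' : ModelWithCorners ℝ E' H'} {M M' : Type*}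
    [TopologicalSpace M] [ChartedSpace H M] [TopologicalSpace M'] [ChartedSpace H' M']
    {f : M → ℝ} {g : M' → ℝ} {φ : M → M'} {x : M} (hfg : f =ᶠ[nhds x] g ∘ φ)
    (hg : MDifferentiableAt I' 𝓘(ℝ, ℝ) g (φ x)) (hφ : MDifferentiableAt I I' φ x)
    (h : mfderiv I' 𝓘(ℝ, ℝ) g (φ x) = 0) : mfderiv I 𝓘(ℝ, ℝ) f x = 0 := by
  rw [hfg.mfderiv_eq, mfderiv_comp x hg hφ, h]
  exact ContinuousLinearMap.zero_comp _

theorem fderiv_eq_zero_iff_mfderiv_eq_zero {E : Type*} [NormedAddCommGroup E] [NormedSpace ℝ E]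
    {f : E → ℝ} {x : E} : fderiv ℝ f x = 0 ↔ mfderiv 𝓘(ℝ, E) 𝓘(ℝ, ℝ) f x = 0 := by
  rw [mfderiv_eq_fderiv]
  rfl

/-- Each function is locally the other composed with a smooth map: the homogeneous potential is `Ũ`
after the projection, and `Ũ` is the homogeneous potential after a section through `v`. The chain
rule then gives both directions without describing tangent spaces. -/
theorem mfderiv_inducedPotential_eq_zero_iff (hn : 2 ≤ n) (hm : ∀ i, 0 < m i) (hI₀ : 0 < I₀)
    (a b : ℝ) {v : Fin (k + 1) → ℂ} (hv : v ≠ 0) {p : projStar e} (hp : CP.mk v hv = p) :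
    mfderiv 𝓘(ℝ, Fin k → ℂ) 𝓘(ℝ, ℝ) (inducedPotential a b I₀ e) p = 0 ↔
      fderiv ℝ (homogeneousPotential e a b I₀) v = 0 := by
  have hc := param_notMem_collision e p.2 _ hp
  constructor
  · intro h
    have hpl : lineStar e p v = p := by
      ext1
      rw [coe_lineStar e hn p hc, hp]
    have heq : homogeneousPotential e a b I₀
        =ᶠ[nhds v] inducedPotential a b I₀ e ∘ lineStar e p := by
      filter_upwards [(isOpen_param_notMem e).mem_nhds hc] with w hw
      exact (inducedPotential_eq e a b I₀ _ (ne_zero_of_param_notMem e hn hw)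
        (coe_lineStar e hn p hw).symm).symm
    have hU : MDifferentiableAt 𝓘(ℝ, Fin k → ℂ) 𝓘(ℝ, ℝ) (inducedPotential a b I₀ e)
        (lineStar e p v) :=
      (contMDiff_inducedPotential e hn hm hI₀ a b _).mdifferentiableAt (by simp)
    refine fderiv_eq_zero_iff_mfderiv_eq_zero.2 (mfderiv_eq_zero_of_eventuallyEq_comp heq hU
      ((contMDiffAt_lineStar e hn p hc).mdifferentiableAt (by simp)) ?_)
    rw [hpl]
    exact h
  · intro h
    obtain ⟨σ, hσ, hsm, heq⟩ := exists_section_eventuallyEq e a b I₀ _ hp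
    subst hσ
    have hU : MDifferentiableAt 𝓘(ℝ, Fin (k + 1) → ℂ) 𝓘(ℝ, ℝ) (homogeneousPotential e a b I₀)
        (σ p) :=
      ((contDiffAt_homogeneousPotential e hn hm hI₀ a b hc).differentiableAt
        (by simp)).mdifferentiableAt
    exact mfderiv_eq_zero_of_eventuallyEq_comp heq hU (hsm.mdifferentiableAt (by simp))
      (fderiv_eq_zero_iff_mfderiv_eq_zero.1 h)

theorem isCentral_iff_fderiv_homogeneousPotential (hn : 2 ≤ n) (hm : ∀ i, 0 < m i) (hI₀ : 0 < I₀)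
    (a b : ℝ) (r : sphereStar m I₀) :
    IsCentral m a b (r : Config n) ↔
      fderiv ℝ (homogeneousPotential e a b I₀) (e ⟨r, r.2.1⟩) = 0 := by
  rw [isCentral_iff_fderiv_comp_normalize hn hm hI₀ a b r.2]
  have hr : param e (e ⟨r, r.2.1⟩) = r := param_coord e r.2.1
  have hd : DifferentiableAt ℝ (fun s => potential m a b (normalize m I₀ s))
      (param e (e ⟨r, r.2.1⟩)) := by
    rw [hr]
    refine DifferentiableAt.comp (r : Config n) (g := potential m a b) ?_
      ((contDiffAt_normalize hm hI₀ (ne_zero_of_notMem_collision hn r.2.2.1)).differentiableAt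
        (by simp))
    rw [normalize_of_inertia_eq hI₀ r.2.2.2]
    exact (contDiffAt_potential m a b r.2.2.1).differentiableAt (by simp)
  have hf : fderiv ℝ (homogeneousPotential e a b I₀) (e ⟨r, r.2.1⟩)
      = (fderiv ℝ (fun s => potential m a b (normalize m I₀ s)) r).comp (param e) := by
    have := hd.hasFDerivAt.comp _ (param e).hasFDerivAt
    rw [hr] at this
    exact this.fderiv
  rw [hf]
  constructor
  · intro h
    ext1 v
    exact h _ (param_mem e v)
  · intro h s hs
    have := DFunLike.congr_fun h (e ⟨s, hs⟩)
    rwa [ContinuousLinearMap.comp_apply, param_coord e hs] at this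

/-! ### The orbit space and the projective space -/

theorem coord_ne_zero (hn : 2 ≤ n) (r : sphereStar m I₀) : e ⟨r, r.2.1⟩ ≠ 0 := by
  rw [e.map_ne_zero_iff]
  intro h
  exact ne_zero_of_notMem_collision hn r.2.2.1 (congrArg Subtype.val h)

theorem orbit_eq_iff {r s : sphereStar m I₀} :
    orbit r = orbit s ↔ ∃ u : Circle, (s : Config n) = (u : ℂ) • (r : Config n) :=
  Quotient.eq

/-- The configuration of moment of inertia `I₀` with homogeneous coordinates `v`. -/
noncomputable def normalizedParam (hn : 2 ≤ n) (hm : ∀ i, 0 < m i) (hI₀ : 0 < I₀)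
    (v : Fin (k + 1) → ℂ) (hv : param e v ∉ collision n) : sphereStar m I₀ :=
  ⟨normalize m I₀ (param e v), normalize_mem_sphereStar hn hm hI₀ (param_mem e v) hv⟩

theorem mk_coord_mem_projStar (hn : 2 ≤ n) (r : sphereStar m I₀) :
    CP.mk (e ⟨r, r.2.1⟩) (coord_ne_zero e hn r) ∈ projStar e := by
  rw [mk_mem_projStar_iff, param_coord]
  exact r.2.2.1

/-- This makes the inverse of the bijection independent of the chosen homogeneous coordinates. -/
theorem orbit_normalizedParam_eq (hn : 2 ≤ n) (hm : ∀ i, 0 < m i) (hI₀ : 0 < I₀)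
    {v w : Fin (k + 1) → ℂ} (hv : param e v ∉ collision n) (hw : param e w ∉ collision n)
    (h : CP.mk v (ne_zero_of_param_notMem e hn hv) = CP.mk w (ne_zero_of_param_notMem e hn hw)) :
    orbit (normalizedParam e hn hm hI₀ v hv) = orbit (normalizedParam e hn hm hI₀ w hw) := by
  obtain ⟨c, rfl⟩ := (CP.mk_eq_mk_iff _ _ _ _).1 h.symm
  have hc : c ≠ 0 := by
    rintro rfl
    exact ne_zero_of_param_notMem e hn hw (zero_smul ℂ v)
  obtain ⟨u, hu⟩ := exists_circle_normalize_smul m I₀ hc (param e v)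
  refine orbit_eq_iff.2 ⟨u, ?_⟩
  simp only [normalizedParam, param_smul, hu]

theorem normalizedParam_coord (hn : 2 ≤ n) (hm : ∀ i, 0 < m i) (hI₀ : 0 < I₀)
    (r : sphereStar m I₀) (h : param e (e ⟨r, r.2.1⟩) ∉ collision n) :
    normalizedParam e hn hm hI₀ (e ⟨r, r.2.1⟩) h = r := by
  ext1
  simp only [normalizedParam, param_coord e r.2.1, normalize_of_inertia_eq hI₀ r.2.2.2]

theorem mk_coord_normalizedParam (hn : 2 ≤ n) (hm : ∀ i, 0 < m i) (hI₀ : 0 < I₀)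
    {v : Fin (k + 1) → ℂ} (hv : param e v ∉ collision n) :
    CP.mk (e ⟨_, (normalizedParam e hn hm hI₀ v hv).2.1⟩) (coord_ne_zero e hn _)
      = CP.mk v (ne_zero_of_param_notMem e hn hv) := by
  refine (CP.mk_eq_mk_iff _ _ _ _).2 ⟨(Real.sqrt (I₀ / inertia m (param e v)) : ℂ), ?_⟩
  rw [← e.symm_apply_eq, map_smul]
  ext1
  exact (normalize_eq_smul m I₀ (param e v)).symm

/-- The bijection of the orbit space onto the projective space minus the collision set. -/
noncomputable def orbitEquiv (hn : 2 ≤ n) (hm : ∀ i, 0 < m i) (hI₀ : 0 < I₀) :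
    OrbitSpace m I₀ ≃ projStar e where
  toFun := Quotient.lift
    (fun r => ⟨CP.mk (e ⟨r, r.2.1⟩) (coord_ne_zero e hn r), mk_coord_mem_projStar e hn r⟩)
    (by
      rintro r s ⟨u, hu⟩
      ext1
      refine ((CP.mk_eq_mk_iff _ _ _ _).2 ⟨(u : ℂ), ?_⟩).symm
      rw [← map_smul]
      exact congrArg e (Subtype.ext hu.symm))
  invFun p := orbit (normalizedParam e hn hm hI₀ (p : CP k).rep
    (param_notMem_collision e p.2 _ (CP.mk_rep (p : CP k))))
  left_inv q := by
    induction q using Quotient.inductionOn with | h r => ?_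
    have h : param e (e ⟨r, r.2.1⟩) ∉ collision n := by
      rw [param_coord]
      exact r.2.2.1
    rw [Quotient.lift_mk]
    conv_rhs => rw [← normalizedParam_coord e hn hm hI₀ r h]
    exact orbit_normalizedParam_eq e hn hm hI₀ _ h (CP.mk_rep _)
  right_inv p := by
    ext1
    exact (mk_coord_normalizedParam e hn hm hI₀ _).trans (CP.mk_rep _)

theorem coe_orbitEquiv_orbit (hn : 2 ≤ n) (hm : ∀ i, 0 < m i) (hI₀ : 0 < I₀)
    (r : sphereStar m I₀) : (orbitEquiv e hn hm hI₀ (orbit r) : CP k)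
      = CP.mk (e ⟨r, r.2.1⟩) (coord_ne_zero e hn r) := rfl

theorem orbitEquiv_symm_eq (hn : 2 ≤ n) (hm : ∀ i, 0 < m i) (hI₀ : 0 < I₀) (p : projStar e)
    {v : Fin (k + 1) → ℂ} (hv : v ≠ 0) (h : CP.mk v hv = p) :
    (orbitEquiv e hn hm hI₀).symm p
      = orbit (normalizedParam e hn hm hI₀ v (param_notMem_collision e p.2 hv h)) := by
  rw [Equiv.symm_apply_eq]
  ext1
  rw [coe_orbitEquiv_orbit, mk_coord_normalizedParam, h]

theorem continuous_orbit : Continuous (orbit : sphereStar m I₀ → OrbitSpace m I₀) :=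
  continuous_quotient_mk'

theorem continuous_orbitEquiv (hn : 2 ≤ n) (hm : ∀ i, 0 < m i) (hI₀ : 0 < I₀) :
    Continuous (orbitEquiv e hn hm hI₀) := by
  refine Continuous.quotient_lift (Continuous.subtype_mk ?_ _) _
  refine (CP.isQuotientMap_mk k).continuous.comp
    (g := fun v : {v : Fin (k + 1) → ℂ // v ≠ 0} => CP.mk v.1 v.2)
    (f := fun r : sphereStar m I₀ => ⟨e ⟨r, r.2.1⟩, coord_ne_zero e hn r⟩) ?_
  exact ((LinearMap.continuous_of_finiteDimensional e.toLinearMap).comp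
    (continuous_subtype_val.subtype_mk _)).subtype_mk _

/-- The inverse is defined through `rep`, an arbitrary choice with no continuity; locally it is
rewritten with a smooth section `σ` as the orbit of the normalization of `σ`. -/
theorem continuous_orbitEquiv_symm (hn : 2 ≤ n) (hm : ∀ i, 0 < m i) (hI₀ : 0 < I₀) :
    Continuous (orbitEquiv e hn hm hI₀).symm := by
  rw [continuous_iff_continuousAt]
  intro p
  obtain ⟨S, σ, hS, hpS, -, hmk, hsm⟩ :=
    exists_local_section_projStar e (CP.rep_ne_zero p) (CP.mk_rep (p : CP k))
  refine ContinuousOn.continuousAt ?_ (hS.mem_nhds hpS)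
  rw [continuousOn_iff_continuous_domRestrict]
  have hc : ∀ q : S, param e (σ q) ∉ collision n := fun q =>
    param_notMem_collision e q.1.2 _ (hmk q q.2).2
  have : S.domRestrict (orbitEquiv e hn hm hI₀).symm
      = fun q : S => orbit (normalizedParam e hn hm hI₀ (σ q) (hc q)) := by
    funext q
    exact orbitEquiv_symm_eq e hn hm hI₀ q _ (hmk q q.2).2
  rw [this]
  refine continuous_orbit.comp (Continuous.subtype_mk ?_ _)
  have hσ : Continuous (S.domRestrict σ) :=
    continuousOn_iff_continuous_domRestrict.1 hsm.continuousOn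
  rw [continuous_iff_continuousAt]
  intro q
  exact ContinuousAt.comp (g := fun w => normalize m I₀ (param e w))
    (contDiffAt_normalize_param e hn hm hI₀ (hc q)).continuousAt hσ.continuousAt

/-- The homeomorphism of the orbit space onto the projective space minus the collision set. -/
noncomputable def orbitHomeomorph (hn : 2 ≤ n) (hm : ∀ i, 0 < m i) (hI₀ : 0 < I₀) :
    OrbitSpace m I₀ ≃ₜ projStar e where
  toEquiv := orbitEquiv e hn hm hI₀
  continuous_toFun := continuous_orbitEquiv e hn hm hI₀
  continuous_invFun := continuous_orbitEquiv_symm e hn hm hI₀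

/-- For every quotient manifold structure on the orbit space, it is diffeomorphic to the
projective space minus the collision set. -/
noncomputable def orbitDiffeomorph (hn : 2 ≤ n) (hm : ∀ i, 0 < m i) (hI₀ : 0 < I₀)
    [ChartedSpace (Fin k → ℂ) (OrbitSpace m I₀)] (hQ : IsQuotientManifold m I₀ k) :
    OrbitSpace m I₀ ≃ₘ^∞⟮𝓘(ℝ, Fin k → ℂ), 𝓘(ℝ, Fin k → ℂ)⟯ projStar e where
  toEquiv := orbitEquiv e hn hm hI₀
  contMDiff_toFun := by
    intro q
    induction q using Quotient.inductionOn with | h r => ?_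
    change ContMDiffAt 𝓘(ℝ, Fin k → ℂ) 𝓘(ℝ, Fin k → ℂ) ∞ _ (orbit r)
    -- Near the orbit of `r` the map is `q ↦ CP.line (E (s q))`, a composite of smooth maps.
    obtain ⟨N, s, hN, hrN, hsr, hs, hsm⟩ := hQ.exists_section r
    obtain ⟨E, hE⟩ := exists_coord_extension e
    rw [← ContMDiffAt.subtypeVal_comp_iff]
    have h₁ : ContMDiffAt 𝓘(ℝ, Fin k → ℂ) 𝓘(ℝ, Fin (k + 1) → ℂ) ∞
        (fun q => E (s q : Config n)) (orbit r) :=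
      E.contDiff.contMDiff.contMDiffAt.comp _ (hsm.contMDiffAt (hN.mem_nhds hrN))
    have h₂ : E (s (orbit r) : Config n) ≠ 0 := by
      rw [hE _ (s (orbit r)).2.1]
      exact coord_ne_zero e hn _
    refine (ContMDiffAt.comp (g := CP.line) (orbit r)
      (CP.contMDiffAt_line h₂) h₁).congr_of_eventuallyEq ?_
    filter_upwards [hN.mem_nhds hrN] with q hq
    have h₃ : (orbitEquiv e hn hm hI₀ q : CP k) = orbitEquiv e hn hm hI₀ (orbit (s q)) := by
      rw [hs q hq]
    simp only [Function.comp_apply, hE _ (s q).2.1]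
    rw [CP.line_of_ne_zero (coord_ne_zero e hn _)]
    exact h₃
  contMDiff_invFun := by
    intro p
    have hp := CP.mk_rep (p : CP k)
    obtain ⟨S, σ, hS, hpS, -, hmk, hsm⟩ :=
      exists_local_section_projStar e (CP.rep_ne_zero p) hp
    have hc : ∀ q ∈ S, param e (σ q) ∉ collision n := fun q hq =>
      param_notMem_collision e q.2 _ (hmk q hq).2
    -- Locally the inverse is a section `σ`, then normalization, then the smooth ambient extension
    -- `F` of the orbit projection.
    obtain ⟨W, F, hW, hrW, hF, hFo⟩ :=
      hQ.smooth_orbit (normalizedParam e hn hm hI₀ (σ p) (hc p hpS))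
    have hν : ContMDiffAt 𝓘(ℝ, Fin k → ℂ) 𝓘(ℝ, Config n) ∞
        (fun q => normalize m I₀ (param e (σ q))) p :=
      (contDiffAt_normalize_param e hn hm hI₀ (hc p hpS)).contMDiffAt.comp p
        (hsm.contMDiffAt (hS.mem_nhds hpS))
    refine (ContMDiffAt.comp p (hF.contMDiffAt (hW.mem_nhds hrW)) hν).congr_of_eventuallyEq ?_
    filter_upwards [hS.mem_nhds hpS, hν.continuousAt (hW.mem_nhds hrW)] with q hq hqW
    exact (orbitEquiv_symm_eq e hn hm hI₀ q _ (hmk q hq).2).trans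
      (hFo (normalizedParam e hn hm hI₀ (σ q) (hc q hq)) hqW).symm

end NBody

/-! ### Transport of a smooth structure along a homeomorphism -/

section Transport

variable {H M N : Type*} [TopologicalSpace H] [TopologicalSpace M] [TopologicalSpace N]
  [ChartedSpace H N]

/-- The charted space structure pulled back by a homeomorphism. -/
@[reducible]
def Homeomorph.pullbackChartedSpace (h : M ≃ₜ N) : ChartedSpace H M where
  atlas := (fun c => h.toOpenPartialHomeomorph.trans c) '' atlas H N
  chartAt x := h.toOpenPartialHomeomorph.trans (chartAt H (h x))
  mem_chart_source x := by simp
  chart_mem_atlas x := ⟨_, chart_mem_atlas H (h x), rfl⟩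

variable {E : Type*} [NormedAddCommGroup E] [NormedSpace ℝ E] (I : ModelWithCorners ℝ E H)

theorem Homeomorph.isManifold_pullback [IsManifold I ∞ N] (h : M ≃ₜ N) :
    @IsManifold ℝ _ E _ _ H _ I ∞ M _ h.pullbackChartedSpace := by
  let : ChartedSpace H M := h.pullbackChartedSpace
  have : HasGroupoid M (contDiffGroupoid ∞ I) := by
    refine ⟨?_⟩
    rintro _ _ ⟨c, hc, rfl⟩ ⟨c', hc', rfl⟩
    have := HasGroupoid.compatible (G := contDiffGroupoid ∞ I) hc hc'
    -- In a transition map of pulled-back charts `h` cancels against its inverse, leaving a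
    -- transition map of `N`.
    refine (contDiffGroupoid ∞ I).mem_of_eqOnSource this ⟨?_, ?_⟩
    · ext x
      simp
    · intro x _
      simp
  exact { }

/-- Read in a chart and its pullback, `h` is the identity. -/
theorem Homeomorph.contMDiff_pullback [IsManifold I ∞ N] (h : M ≃ₜ N) :
    letI : ChartedSpace H M := h.pullbackChartedSpace
    ContMDiff I I ∞ h := by
  let : ChartedSpace H M := h.pullbackChartedSpace
  have := h.isManifold_pullback I
  intro x
  have h₁ : ContMDiffAt I I ∞ (chartAt H x) x :=
    (contMDiffOn_chart (I := I) (x := x)).contMDiffAt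
      ((chartAt H x).open_source.mem_nhds (mem_chart_source H x))
  have h₂ : ContMDiffAt I I ∞ (chartAt H (h x)).symm (chartAt H x x) :=
    (contMDiffOn_chart_symm (I := I) (x := h x)).contMDiffAt
      ((chartAt H (h x)).open_target.mem_nhds (mem_chart_target H (h x)))
  refine (h₂.comp x h₁).congr_of_eventuallyEq ?_
  filter_upwards [(chartAt H x).open_source.mem_nhds (mem_chart_source H x)] with y hy
  have hy : h y ∈ (chartAt H (h x)).source := by
    have hy : y ∈ (h.toOpenPartialHomeomorph.trans (chartAt H (h x))).source := hy
    rw [OpenPartialHomeomorph.trans_source] at hy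
    exact hy.2
  exact ((chartAt H (h x)).left_inv hy).symm

theorem Homeomorph.contMDiff_symm_pullback [IsManifold I ∞ N] (h : M ≃ₜ N) :
    letI : ChartedSpace H M := h.pullbackChartedSpace
    ContMDiff I I ∞ h.symm := by
  let : ChartedSpace H M := h.pullbackChartedSpace
  have := h.isManifold_pullback I
  intro y
  obtain ⟨x, rfl⟩ := h.surjective y
  have h₁ : ContMDiffAt I I ∞ (chartAt H (h x)) (h x) :=
    (contMDiffOn_chart (I := I) (x := h x)).contMDiffAt
      ((chartAt H (h x)).open_source.mem_nhds (mem_chart_source H (h x)))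
  have h₂ : ContMDiffAt I I ∞ (chartAt H x).symm (chartAt H (h x) (h x)) :=
    (contMDiffOn_chart_symm (I := I) (x := x)).contMDiffAt
      ((chartAt H x).open_target.mem_nhds (mem_chart_target H x))
  refine (h₂.comp (h x) h₁).congr_of_eventuallyEq ?_
  filter_upwards [(chartAt H (h x)).open_source.mem_nhds (mem_chart_source H (h x))] with y hy
  exact congrArg h.symm ((chartAt H (h x)).left_inv hy).symm

end Transport

/-! ### Existence of the quotient structure and the correspondence of critical points -/

namespace NBody

variable {n k : ℕ} {m : Fin n → ℝ} {I₀ : ℝ}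

/-- With the structure pulled back from projective space, the orbit projection is smooth because `v
↦ ℂv` is, and its local sections are normalized local sections of that map. -/
theorem exists_isQuotientManifold (e : centered m ≃ₗ[ℂ] (Fin (k + 1) → ℂ))
    (hn : 2 ≤ n) (hm : ∀ i, 0 < m i) (hI₀ : 0 < I₀) :
    ∃ _ : ChartedSpace (Fin k → ℂ) (OrbitSpace m I₀), IsQuotientManifold m I₀ k := by
  let φ := orbitHomeomorph e hn hm hI₀
  let : ChartedSpace (Fin k → ℂ) (OrbitSpace m I₀) := φ.pullbackChartedSpace
  refine ⟨φ.pullbackChartedSpace, φ.isManifold_pullback _, fun x => ?_, fun r => ?_⟩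
  · obtain ⟨E, hE⟩ := exists_coord_extension e
    refine ⟨{w | param e (E w) ∉ collision n},
      -- The default line `φ (orbit x)` is never taken on the chosen open set, where `E w` gives no
      -- collision.
      fun w => φ.symm (lineStar e (φ (orbit x)) (E w)), ?_, ?_, ?_, fun y hy => ?_⟩
    · exact (isOpen_param_notMem e).preimage E.continuous
    · rw [Set.mem_ofPred_eq, hE _ x.2.1, param_coord]
      exact x.2.2.1
    · intro w hw
      exact ((φ.contMDiff_symm_pullback 𝓘(ℝ, Fin k → ℂ) _).comp w
        (ContMDiffAt.comp w (contMDiffAt_lineStar e hn _ hw)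
          E.contDiff.contMDiff.contMDiffAt)).contMDiffWithinAt
    · change φ.symm _ = _
      rw [Homeomorph.symm_apply_eq]
      ext1
      refine (coe_lineStar e hn _ hy).trans (Eq.trans ?_ (coe_orbitEquiv_orbit e hn hm hI₀ y).symm)
      simp only [hE _ y.2.1]
  · obtain ⟨S, σ, hS, hrS, hσ, hmk, hsm⟩ := exists_local_section_projStar e
      (coord_ne_zero e hn r) (p := φ (orbit r)) rfl
    classical
    -- A section must be defined everywhere; the default `r` is not used on `φ ⁻¹' S`.
    let s : OrbitSpace m I₀ → sphereStar m I₀ := fun q =>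
      if h : param e (σ (φ q)) ∉ collision n then normalizedParam e hn hm hI₀ (σ (φ q)) h else r
    have hc : ∀ q ∈ φ ⁻¹' S, param e (σ (φ q)) ∉ collision n := fun q hq =>
      param_notMem_collision e (φ q).2 _ (hmk _ hq).2
    have hs : ∀ q (hq : q ∈ φ ⁻¹' S), s q = normalizedParam e hn hm hI₀ (σ (φ q)) (hc q hq) :=
      fun q hq => dif_pos (hc q hq)
    refine ⟨φ ⁻¹' S, s, hS.preimage φ.continuous, hrS, ?_, fun q hq => ?_, ?_⟩
    · rw [hs _ hrS]
      simp only [hσ]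
      exact normalizedParam_coord e hn hm hI₀ r _
    · rw [hs q hq]
      exact (orbitEquiv_symm_eq e hn hm hI₀ (φ q) _ (hmk _ hq).2).symm.trans
        (φ.symm_apply_apply q)
    · have h : ContMDiffOn 𝓘(ℝ, Fin k → ℂ) 𝓘(ℝ, Config n) ∞
          (fun q => normalize m I₀ (param e (σ (φ q)))) (φ ⁻¹' S) := by
        intro q hq
        have h₁ : ContMDiffAt 𝓘(ℝ, Fin k → ℂ) 𝓘(ℝ, Fin (k + 1) → ℂ) ∞ (fun q => σ (φ q)) q :=
          ContMDiffAt.comp q (hsm.contMDiffAt (hS.mem_nhds hq))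
            (φ.contMDiff_pullback 𝓘(ℝ, Fin k → ℂ) q)
        exact ((contDiffAt_normalize_param e hn hm hI₀ (hc q hq)).contMDiffAt.comp q
          h₁).contMDiffWithinAt
      refine h.congr fun q hq => ?_
      rw [hs q hq]
      rfl

variable (e : centered m ≃ₗ[ℂ] (Fin (k + 1) → ℂ))

theorem image_orbitEquiv_centralClasses (hn : 2 ≤ n) (hm : ∀ i, 0 < m i) (hI₀ : 0 < I₀)
    (a b : ℝ) : orbitEquiv e hn hm hI₀ '' centralClasses m a b I₀
      = criticalSet k (inducedPotential a b I₀ e) := by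
  have key : ∀ r : sphereStar m I₀, IsCentral m a b (r : Config n) ↔
      orbitEquiv e hn hm hI₀ (orbit r) ∈ criticalSet k (inducedPotential a b I₀ e) := by
    intro r
    rw [isCentral_iff_fderiv_homogeneousPotential e hn hm hI₀ a b r,
      ← mfderiv_inducedPotential_eq_zero_iff e hn hm hI₀ a b (coord_ne_zero e hn r)
        (coe_orbitEquiv_orbit e hn hm hI₀ r).symm]
    -- Differentiability, the other half of being critical, is automatic as `Ũ` is smooth.
    exact (and_iff_right
      ((contMDiff_inducedPotential e hn hm hI₀ a b _).mdifferentiableAt (by simp))).symm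
  ext p
  constructor
  · rintro ⟨_, ⟨r, hr, rfl⟩, rfl⟩
    exact (key r).1 hr
  · intro hp
    obtain ⟨q, rfl⟩ := (orbitEquiv e hn hm hI₀).surjective p
    induction q using Quotient.inductionOn with | h r => ?_
    exact ⟨_, ⟨r, (key r).2 hp, rfl⟩, rfl⟩

theorem inducedPotential_orbitEquiv (hn : 2 ≤ n) (hm : ∀ i, 0 < m i) (hI₀ : 0 < I₀) (a b : ℝ)
    (r : sphereStar m I₀) :
    inducedPotential a b I₀ e (orbitEquiv e hn hm hI₀ (orbit r)) = potential m a b r := by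
  rw [inducedPotential_eq e a b I₀ _ (coord_ne_zero e hn r)
    (coe_orbitEquiv_orbit e hn hm hI₀ r).symm, homogeneousPotential, param_coord,
    normalize_of_inertia_eq hI₀ r.2.2.2]

end NBody

theorem proposition1 (n : ℕ) (hn : 2 ≤ n) (m : Fin n → ℝ) (hm : ∀ i, 0 < m i)
    (a b : ℝ) (ha : 0 ≤ a) (hab : a < b) (I₀ : ℝ) (hI₀ : 0 < I₀)
    (e : NBody.centered m ≃ₗ[ℂ] (Fin (n - 2 + 1) → ℂ)) :
    ContMDiff 𝓘(ℝ, Fin (n - 2) → ℂ) 𝓘(ℝ, ℝ) ∞ (NBody.inducedPotential a b I₀ e) ∧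
    (∃ _ : ChartedSpace (Fin (n - 2) → ℂ) (NBody.OrbitSpace m I₀),
      NBody.IsQuotientManifold m I₀ (n - 2)) ∧
    ∀ _ : ChartedSpace (Fin (n - 2) → ℂ) (NBody.OrbitSpace m I₀),
      NBody.IsQuotientManifold m I₀ (n - 2) →
      ∃ Φ : NBody.OrbitSpace m I₀
          ≃ₘ^∞⟮𝓘(ℝ, Fin (n - 2) → ℂ), 𝓘(ℝ, Fin (n - 2) → ℂ)⟯ NBody.projStar e,
        (∀ r : NBody.sphereStar m I₀, ∃ hr : e ⟨r, r.2.1⟩ ≠ 0,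
          (Φ (NBody.orbit r) : CP (n - 2)) = CP.mk (e ⟨r, r.2.1⟩) hr) ∧
        (∀ r : NBody.sphereStar m I₀,
          NBody.inducedPotential a b I₀ e (Φ (NBody.orbit r)) = NBody.potential m a b r) ∧
        Φ '' NBody.centralClasses m a b I₀
          = NBody.criticalSet (n - 2) (NBody.inducedPotential a b I₀ e) := by
  refine ⟨NBody.contMDiff_inducedPotential e hn hm hI₀ a b,
    NBody.exists_isQuotientManifold e hn hm hI₀, fun _ hQ => ?_⟩
  -- The underlying map is `orbitEquiv` whatever the structure on the orbit space, so its pointwise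
  -- properties apply unchanged.
  exact ⟨NBody.orbitDiffeomorph e hn hm hI₀ hQ,
    fun r => ⟨NBody.coord_ne_zero e hn r, NBody.coe_orbitEquiv_orbit e hn hm hI₀ r⟩,
    NBody.inducedPotential_orbitEquiv e hn hm hI₀ a b,
    NBody.image_orbitEquiv_centralClasses e hn hm hI₀ a b⟩
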